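/- Let $\mathbb{X}$ be a semi-abelian category, that is, a category with a zero object and finite coproducts which is Barr exact and Bourn protomodular. A cospan is a pair of morphisms $(x\colon X\to D,\ y\colon Y\to D)$; a weighted cospan $(x,y,w)$ consists of a cospan $(x,y)$ and a morphism $w\colon W\to D$, its weight. The morphisms $x,y$ *Huq-commute* if there is $\varphi\colon X\times Y\to D$ with $\varphi\circ\langle 1_X,0\rangle=x$ and $\varphi\circ\langle 0,1_Y\rangle=y$. They *commute over* $w$ if there is a morphism $\varphi\colon (W+X)\times_W(W+Y)\to D$, the pullback being taken along $f=[1_W,0]\colon W+X\to W$ and $g=[1_W,0]\colon W+Y\to W$, such that $\varphi\circ\langle 1_{W+X},\iota_W f\rangle=[w,x]$ and $\varphi\circ\langle \iota_W g,1_{W+Y}\rangle=[w,y]$, where $\iota_W$ denotes the coproduct inclusions of $W$. For subobjects $k\colon K\to D$, $l\colon L\to D$, $m\colon M\to D$, the Higgins commutator $[K,L]\leq D$ is the image of the restriction of $[k,l]\colon K+L\to D$ to the kernel of the canonical morphism $K+L\to K\times L$, and the ternary commutator $[K,L,M]\leq D$ is the image of the restriction of $[k,l,m]\colon K+L+M\to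 D$ to the kernel of the canonical morphism $K+L+M\to (K+L)\times(K+M)\times(L+M)$, whose components send the missing summand to zero and include the other two. Then the following conditions on $\mathbb{X}$ are equivalent: 1. for every weighted cospan $(x,y,w)$, if $x$ and $y$ Huq-commute then they commute over $w$; 2. for every cospan $(x,y)$, the property of commuting over $w$ is independent of the weight: for all $w\colon W\to D$ and $w'\colon W'\to D$, $x$ and $y$ commute over $w$ if and only if they commute over $w'$; 3. for every weighted cospan $(x,y,w)$, if $[\mathrm{Im}(x),\mathrm{Im}(y)]=0$ then $[\mathrm{Im}(x),\mathrm{Im}(y),\mathrm{Im}(w)]=0$; 4. any one of the conditions 1, 2, 3 restricted to those cospans $(x,y)$ in which $x$ and $y$ are monomorphisms (the weights $w$, $w'$ remaining arbitrary). -/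

import Mathlib

open CategoryTheory CategoryTheory.Limits

universe v u

noncomputable section

/-- A semi-abelian category (Janelidze, Márki, Tholen): a category with a zero object and finite
coproducts which is Barr exact (regular, and every internal equivalence relation is a kernel pair)
and Bourn protomodular. For a pointed category with kernels of split epimorphisms, protomodularity
is the Split Short Five Lemma: a morphism of split epimorphisms which is an isomorphism on the
bases and on the kernels is an isomorphism. The `HasZeroMorphisms` structure is no extra data: it is
unique, and it is forced by the zero object. -/
class SemiAbelian (C : Type u) [Category.{v} C] [HasZeroMorphisms C] : Prop extends
    Regular C, HasZeroObject C where
  /-- Finite coproducts exist. -/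
  hasFiniteCoproducts : HasFiniteCoproducts C
  /-- Barr exactness: every internal equivalence relation is a kernel pair. -/
  exists_isKernelPair : ∀ {R A : C} (p₁ p₂ : R ⟶ A), IsEquivalenceRelation p₁ p₂ →
    ∃ (B : C) (q : A ⟶ B), IsKernelPair q p₁ p₂
  /-- Protomodularity, as the Split Short Five Lemma. -/
  splitShortFive : ∀ {A B A' B' : C} (f : A ⟶ B) (s : B ⟶ A) (f' : A' ⟶ B') (s' : B' ⟶ A')
    (a : A ⟶ A') (b : B ⟶ B') (_ : s ≫ f = 𝟙 B) (_ : s' ≫ f' = 𝟙 B')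
    (w : f ≫ b = a ≫ f') (_ : s ≫ a = b ≫ s'),
    IsIso b → IsIso (kernel.map f f' a b w) → IsIso a

attribute [instance] SemiAbelian.hasFiniteCoproducts

namespace SemiAbelian

variable {C : Type u} [Category.{v} C] [HasZeroMorphisms C] [SemiAbelian C]

/-- `x` and `y` Huq-commute: there is `φ : X × Y ⟶ D` with `φ ∘ ⟨1, 0⟩ = x` and
`φ ∘ ⟨0, 1⟩ = y`. -/
def HuqCommute {X Y D : C} (x : X ⟶ D) (y : Y ⟶ D) : Prop :=
  ∃ φ : X ⨯ Y ⟶ D, prod.lift (𝟙 X) 0 ≫ φ = x ∧ prod.lift 0 (𝟙 Y) ≫ φ = y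

/-- The split epimorphism `[1, 0] : W + X ⟶ W`, with section the coproduct inclusion of `W`. -/
def weightProj (W X : C) : W ⨿ X ⟶ W := coprod.desc (𝟙 W) 0

theorem inl_weightProj (W X : C) : coprod.inl ≫ weightProj W X = 𝟙 W := coprod.inl_desc _ _

/-- `e₁ = ⟨1, ι_W ∘ [1, 0]⟩ : W + X ⟶ (W + X) ×_W (W + Y)`. -/
def weightLeft (W X Y : C) : W ⨿ X ⟶ pullback (weightProj W X) (weightProj W Y) :=
  pullback.lift (𝟙 (W ⨿ X)) (weightProj W X ≫ coprod.inl)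
    (by rw [Category.id_comp, Category.assoc, inl_weightProj, Category.comp_id])

/-- `e₂ = ⟨ι_W ∘ [1, 0], 1⟩ : W + Y ⟶ (W + X) ×_W (W + Y)`. -/
def weightRight (W X Y : C) : W ⨿ Y ⟶ pullback (weightProj W X) (weightProj W Y) :=
  pullback.lift (weightProj W Y ≫ coprod.inl) (𝟙 (W ⨿ Y))
    (by rw [Category.id_comp, Category.assoc, inl_weightProj, Category.comp_id])

/-- `x` and `y` commute over the weight `w`: the triple `([w, x], w, [w, y])` is admissible with
respect to `([1, 0], ι_W, [1, 0], ι_W)`, that is, there is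
`φ : (W + X) ×_W (W + Y) ⟶ D` with `φ ∘ e₁ = [w, x]` and `φ ∘ e₂ = [w, y]`. -/
def CommuteOver {X Y W D : C} (x : X ⟶ D) (y : Y ⟶ D) (w : W ⟶ D) : Prop :=
  ∃ φ : pullback (weightProj W X) (weightProj W Y) ⟶ D,
    weightLeft W X Y ≫ φ = coprod.desc w x ∧ weightRight W X Y ≫ φ = coprod.desc w y

/-- The comparison `K + L ⟶ K × L` given by the identity matrix. -/
def coprodToProd (K L : C) : K ⨿ L ⟶ K ⨯ L :=
  coprod.desc (prod.lift (𝟙 K) 0) (prod.lift 0 (𝟙 L))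

/-- The comparison `K + L + M ⟶ (K + L) × (K + M) × (L + M)`, whose components send the summand
that is missing in the codomain to zero and include the other two. Its kernel is the ternary
co-smash product. -/
def coprodToProd₃ (K L M : C) : (K ⨿ L) ⨿ M ⟶ (K ⨿ L) ⨯ ((K ⨿ M) ⨯ (L ⨿ M)) :=
  prod.lift (coprod.desc (𝟙 (K ⨿ L)) 0)
    (prod.lift (coprod.desc (coprod.desc coprod.inl 0) coprod.inr)
      (coprod.desc (coprod.desc 0 coprod.inl) coprod.inr))

/-- The binary Higgins commutator `[K, L]` of two subobjects of `D`: the image of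
`K ⋄ L ⟶ K + L ⟶ D`, where `K ⋄ L` is the kernel of `K + L ⟶ K × L`. -/
def higgins {D : C} (K L : Subobject D) : Subobject D :=
  imageSubobject (kernel.ι (coprodToProd (K : C) (L : C)) ≫ coprod.desc K.arrow L.arrow)

/-- The ternary Higgins commutator `[K, L, M]` of three subobjects of `D`: the image of
`K ⋄ L ⋄ M ⟶ K + L + M ⟶ D`. -/
def higgins₃ {D : C} (K L M : Subobject D) : Subobject D :=
  imageSubobject (kernel.ι (coprodToProd₃ (K : C) (L : C) (M : C)) ≫
    coprod.desc (coprod.desc K.arrow L.arrow) M.arrow)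

end SemiAbelian

end

/-! Both notions of commutation say that a copairing vanishes on the kernel of a regular
epimorphism: `X + Y ⟶ X × Y` for Huq-commutation (`huqCommute_iff`), `X + Y + W ⟶ (W + X) ×_W (W +
Y)` for commutation over `w` (`commuteOver_iff_kernel_comp`). Killing `W` maps the second kernel
onto the first, split by the inclusion, and the kernel of this retraction is the ternary co-smash
product. By protomodularity, commuting over `w` therefore amounts to Huq-commuting plus vanishing of
`[x, y, w]` on the ternary co-smash product (`HuqCommute.commuteOver`). Conditions on images
transfer because Huq-commutation descends along strong epimorphisms and the ternary co-smash product
is natural. A zero weight adds nothing to Huq-commutation, which gives independence of the weight.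
-/

namespace SemiAbelian

variable {C : Type u} [Category.{v} C] [HasZeroMorphisms C] [SemiAbelian C]

attribute [local simp] prod.lift_fst prod.lift_fst_assoc prod.lift_snd prod.lift_snd_assoc
  coprod.inl_desc coprod.inl_desc_assoc coprod.inr_desc coprod.inr_desc_assoc
  pullback.lift_fst pullback.lift_fst_assoc pullback.lift_snd pullback.lift_snd_assoc

/-! ### Consequences of protomodularity -/

/-- In a semi-abelian category, the section and the kernel of a split epimorphism are jointly
extremal-epic. -/
theorem isIso_of_section_of_kernel {A B S : C} (f : A ⟶ B) (s : B ⟶ A) (hs : s ≫ f = 𝟙 B)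
    (m : S ⟶ A) [Mono m] (t : B ⟶ S) (ht : t ≫ m = s)
    (k : kernel f ⟶ S) (hk : k ≫ m = kernel.ι f) : IsIso m := by
  have hkm : k ≫ m ≫ f = 0 := by rw [← Category.assoc, hk, kernel.condition]
  -- `m` is a morphism of split epimorphisms over the identity; `k` supplies the inverse on kernels.
  refine SemiAbelian.splitShortFive (m ≫ f) t f s m (𝟙 B) (by rw [← Category.assoc, ht, hs]) hs
    (by simp) (by simp [ht]) inferInstance ⟨kernel.lift _ k hkm, ?_, ?_⟩
  · rw [← cancel_mono (kernel.ι (m ≫ f)), ← cancel_mono m]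
    simp [hk]
  · rw [← cancel_mono (kernel.ι f)]
    simp [hk]

/-- In a semi-abelian category, the section and the kernel of a split epimorphism are jointly
epic. -/
theorem hom_ext_of_section_of_kernel {A B D : C} (f : A ⟶ B) (s : B ⟶ A) (hs : s ≫ f = 𝟙 B)
    {g h : A ⟶ D} (h₁ : s ≫ g = s ≫ h) (h₂ : kernel.ι f ≫ g = kernel.ι f ≫ h) : g = h := by
  have := isIso_of_section_of_kernel f s hs (equalizer.ι g h) (equalizer.lift s h₁)
    (equalizer.lift_ι _ _) (equalizer.lift (kernel.ι f) h₂) (equalizer.lift_ι _ _)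
  rw [← cancel_epi (equalizer.ι g h), equalizer.condition]

/-- Regular epimorphisms in a semi-abelian category are cokernels of their kernels. -/
theorem exists_fac_of_kernel_comp_eq_zero {A B D : C} (q : A ⟶ B) [IsRegularEpi q] (g : A ⟶ D)
    (hg : kernel.ι q ≫ g = 0) : ∃ φ : B ⟶ D, q ≫ φ = g := by
  have key : pullback.fst q q ≫ g = pullback.snd q q ≫ g := by
    -- The diagonal splits the kernel pair, and the first projection sends the kernel of the second
    -- into the kernel of `q`, where `g` vanishes.
    refine hom_ext_of_section_of_kernel (pullback.snd q q) (pullback.lift (𝟙 A) (𝟙 A) rfl)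
      (by simp) (by simp) ?_
    have h₁ : (kernel.ι (pullback.snd q q) ≫ pullback.fst q q) ≫ q = 0 := by
      rw [Category.assoc, pullback.condition, kernel.condition_assoc, zero_comp]
    rw [kernel.condition_assoc, zero_comp, ← Category.assoc, ← kernel.lift_ι q _ h₁,
      Category.assoc, hg, comp_zero]
  refine ⟨IsRegularEpi.desc q g ?_, IsRegularEpi.fac q g _⟩
  simpa using congrArg (pullback.lift _ _ (IsRegularEpi.w q) ≫ ·) key

/-! ### Huq-commutation, binary co-smash products and images -/

theorem isIso_of_prod_inclusions {X Y S : C} (m : S ⟶ X ⨯ Y) [Mono m] (a : X ⟶ S)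
    (ha : a ≫ m = prod.lift (𝟙 X) 0) (b : Y ⟶ S) (hb : b ≫ m = prod.lift 0 (𝟙 Y)) : IsIso m := by
  refine isIso_of_section_of_kernel prod.snd (prod.lift 0 (𝟙 Y)) (by simp) m b hb
    (kernel.ι prod.snd ≫ prod.fst ≫ a) ?_
  ext <;> simp [ha]

instance regularEpi_coprodToProd (X Y : C) : IsRegularEpi (coprodToProd X Y) := by
  have := ExtremalEpi.mk_of_hasEqualizers (coprodToProd X Y) fun S e m h _ =>
    isIso_of_prod_inclusions m (coprod.inl ≫ e) (by simp [h, coprodToProd])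
      (coprod.inr ≫ e) (by simp [h, coprodToProd])
  infer_instance

/-- Two morphisms Huq-commute if and only if their copairing vanishes on the co-smash product. -/
theorem huqCommute_iff {X Y D : C} (x : X ⟶ D) (y : Y ⟶ D) :
    HuqCommute x y ↔ kernel.ι (coprodToProd X Y) ≫ coprod.desc x y = 0 := by
  constructor
  · rintro ⟨φ, hx, hy⟩
    have : coprodToProd X Y ≫ φ = coprod.desc x y := by
      ext <;> simp [coprodToProd, hx, hy]
    rw [← this, kernel.condition_assoc, zero_comp]
  · intro h
    obtain ⟨φ, hφ⟩ := exists_fac_of_kernel_comp_eq_zero _ _ h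
    refine ⟨φ, ?_, ?_⟩
    · simpa [coprodToProd] using congrArg (coprod.inl ≫ ·) hφ
    · simpa [coprodToProd] using congrArg (coprod.inr ≫ ·) hφ

theorem HuqCommute.symm {X Y D : C} {x : X ⟶ D} {y : Y ⟶ D} (h : HuqCommute x y) :
    HuqCommute y x := by
  obtain ⟨φ, hx, hy⟩ := h
  refine ⟨(prod.braiding Y X).hom ≫ φ, ?_, ?_⟩
  · rw [← hy, ← Category.assoc]; congr 1; ext <;> simp
  · rw [← hx, ← Category.assoc]; congr 1; ext <;> simp

theorem regularEpi_prod_map_id {X X' : C} (e : X ⟶ X') [StrongEpi e] (Y : C) :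
    IsRegularEpi (prod.map e (𝟙 Y)) := by
  have := ExtremalEpi.mk_of_hasEqualizers (prod.map e (𝟙 Y)) fun S p m h _ => by
    have sq : CommSq (prod.lift (𝟙 X) 0 ≫ p) e m (prod.lift (𝟙 X') 0) :=
      ⟨by rw [Category.assoc, h]; ext <;> simp⟩
    refine isIso_of_prod_inclusions m sq.lift sq.fac_right (prod.lift 0 (𝟙 Y) ≫ p) ?_
    rw [Category.assoc, h]
    ext <;> simp
  infer_instance

/-- Huq-commutation descends along strong epimorphisms. -/
theorem HuqCommute.of_strongEpi_comp {X X' Y D : C} (e : X ⟶ X') [StrongEpi e] {x : X' ⟶ D}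
    {y : Y ⟶ D} (h : HuqCommute (e ≫ x) y) : HuqCommute x y := by
  obtain ⟨φ, hx, hy⟩ := h
  have := regularEpi_prod_map_id e Y
  -- The kernel of `e × 1` lies in `X × 0`, where `φ` is `e ≫ x`.
  obtain ⟨ψ, hψ⟩ := exists_fac_of_kernel_comp_eq_zero (prod.map e (𝟙 Y)) φ (by
    have hc := kernel.condition (prod.map e (𝟙 Y))
    have h₁ : kernel.ι (prod.map e (𝟙 Y)) ≫ prod.fst ≫ e = 0 := by
      rw [← prod.map_fst e (𝟙 Y), reassoc_of% hc, zero_comp]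
    have h₂ : kernel.ι (prod.map e (𝟙 Y)) ≫ prod.snd = 0 := by
      rw [← Category.comp_id prod.snd, ← prod.map_snd e (𝟙 Y), reassoc_of% hc, zero_comp]
    have h₃ : kernel.ι (prod.map e (𝟙 Y)) =
        (kernel.ι (prod.map e (𝟙 Y)) ≫ prod.fst) ≫ prod.lift (𝟙 X) 0 := by
      ext <;> simp [h₂]
    rw [h₃, Category.assoc, hx, Category.assoc, reassoc_of% h₁, zero_comp])
  refine ⟨ψ, ?_, ?_⟩
  · rw [← cancel_epi e, ← hx, ← hψ, ← Category.assoc, ← Category.assoc]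
    congr 1
    ext <;> simp
  · rw [← hy, ← hψ, ← Category.assoc]
    congr 1
    ext <;> simp

instance strongEpi_factorThruImageSubobject {X D : C} (x : X ⟶ D) :
    StrongEpi (factorThruImageSubobject x) := by
  dsimp [factorThruImageSubobject]
  infer_instance

theorem HuqCommute.imageSubobject {X Y D : C} {x : X ⟶ D} {y : Y ⟶ D} (h : HuqCommute x y) :
    HuqCommute (imageSubobject x).arrow (imageSubobject y).arrow := by
  refine .of_strongEpi_comp (factorThruImageSubobject x) (.symm ?_)
  refine .of_strongEpi_comp (factorThruImageSubobject y) (.symm ?_)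
  simpa using h

theorem imageSubobject_eq_bot_iff {X D : C} (x : X ⟶ D) : imageSubobject x = ⊥ ↔ x = 0 := by
  constructor
  · intro h
    have hx : (⊥ : Subobject D).Factors x := by
      simpa [h] using imageSubobject_factors_comp_self x (𝟙 X)
    exact (Subobject.bot_factors_iff_zero x).1 hx
  · rintro rfl
    exact imageSubobject_zero

theorem imageSubobject_imageSubobject_arrow {X D : C} (x : X ⟶ D) :
    Limits.imageSubobject (imageSubobject x).arrow = imageSubobject x := by
  rw [imageSubobject_mono, Subobject.mk_arrow]

theorem higgins_eq_bot_iff {D : C} (K L : Subobject D) :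
    higgins K L = ⊥ ↔ HuqCommute K.arrow L.arrow := by
  rw [higgins, imageSubobject_eq_bot_iff, huqCommute_iff]

/-! ### The weighted pullback as a quotient of `X + Y + W` -/

@[simp]
theorem weightLeft_fst (X Y W : C) : weightLeft W X Y ≫ pullback.fst _ _ = 𝟙 (W ⨿ X) :=
  pullback.lift_fst _ _ _

@[simp]
theorem weightLeft_snd (X Y W : C) :
    weightLeft W X Y ≫ pullback.snd _ _ = weightProj W X ≫ coprod.inl :=
  pullback.lift_snd _ _ _

@[simp]
theorem weightRight_fst (X Y W : C) :
    weightRight W X Y ≫ pullback.fst _ _ = weightProj W Y ≫ coprod.inl :=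
  pullback.lift_fst _ _ _

@[simp]
theorem weightRight_snd (X Y W : C) : weightRight W X Y ≫ pullback.snd _ _ = 𝟙 (W ⨿ Y) :=
  pullback.lift_snd _ _ _

@[simp]
theorem inl_weightProj_assoc (W X : C) {Z : C} (h : W ⟶ Z) :
    coprod.inl ≫ weightProj W X ≫ h = h :=
  coprod.inl_desc_assoc _ _ _ |>.trans (Category.id_comp h)

@[simp]
theorem inr_weightProj (W X : C) : coprod.inr ≫ weightProj W X = 0 :=
  coprod.inr_desc _ _

@[simp]
theorem inr_weightProj_assoc (W X : C) {Z : C} (h : W ⟶ Z) :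
    coprod.inr ≫ weightProj W X ≫ h = 0 :=
  coprod.inr_desc_assoc _ _ _ |>.trans zero_comp

/-- The canonical morphism `X + Y + W ⟶ (W + X) ×_W (W + Y)`. -/
noncomputable def coprodToPullback (X Y W : C) :
    (X ⨿ Y) ⨿ W ⟶ pullback (weightProj W X) (weightProj W Y) :=
  coprod.desc (coprod.desc (coprod.inr ≫ weightLeft W X Y) (coprod.inr ≫ weightRight W X Y))
    (coprod.inl ≫ weightLeft W X Y)

theorem inl_weightLeft (X Y W : C) :
    coprod.inl ≫ weightLeft W X Y = coprod.inl ≫ weightRight W X Y := by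
  apply pullback.hom_ext <;> simp

theorem coprodToPullback_comp_eq_iff {X Y W D : C} (x : X ⟶ D) (y : Y ⟶ D) (w : W ⟶ D)
    (φ : pullback (weightProj W X) (weightProj W Y) ⟶ D) :
    coprodToPullback X Y W ≫ φ = coprod.desc (coprod.desc x y) w ↔
      weightLeft W X Y ≫ φ = coprod.desc w x ∧ weightRight W X Y ≫ φ = coprod.desc w y := by
  constructor
  · intro h
    have h₁ : coprod.inr ≫ weightLeft W X Y ≫ φ = x := by
      simpa [coprodToPullback] using congrArg (coprod.inl ≫ coprod.inl ≫ ·) h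
    have h₂ : coprod.inr ≫ weightRight W X Y ≫ φ = y := by
      simpa [coprodToPullback] using congrArg (coprod.inr ≫ coprod.inl ≫ ·) h
    have h₃ : coprod.inl ≫ weightLeft W X Y ≫ φ = w := by
      simpa [coprodToPullback] using congrArg (coprod.inr ≫ ·) h
    have h₄ : coprod.inl ≫ weightRight W X Y ≫ φ = w := by
      rw [← h₃, ← Category.assoc, ← inl_weightLeft, Category.assoc]
    constructor <;> ext <;> simp [*]
  · rintro ⟨h₁, h₂⟩
    ext <;> simp [coprodToPullback, h₁, h₂]

instance regularEpi_coprodToPullback (X Y W : C) : IsRegularEpi (coprodToPullback X Y W) := by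
  have := ExtremalEpi.mk_of_hasEqualizers (coprodToPullback X Y W) fun S e m h _ => by
    have h₁ : coprod.desc (coprod.inr ≫ e) (coprod.inl ≫ coprod.inl ≫ e) ≫ m =
        weightLeft W X Y := by
      ext <;> simp [h, coprodToPullback]
    have h₂ : coprod.desc (coprod.inr ≫ e) (coprod.inr ≫ coprod.inl ≫ e) ≫ m =
        weightRight W X Y := by
      ext1 <;> simp [h, coprodToPullback, inl_weightLeft]
    -- On this kernel the second coordinate is zero, hence the first is killed by `weightProj W X`,
    -- so `weightLeft` recovers the pair.
    have h₃ : (kernel.ι (pullback.snd (weightProj W X) (weightProj W Y)) ≫ pullback.fst _ _) ≫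
        weightLeft W X Y = kernel.ι (pullback.snd (weightProj W X) (weightProj W Y)) := by
      apply pullback.hom_ext
      · simp
      · simp [pullback.condition_assoc]
    exact isIso_of_section_of_kernel (pullback.snd _ _) (weightRight W X Y) (weightRight_snd X Y W)
      m _ h₂ ((kernel.ι _ ≫ pullback.fst _ _) ≫ _) (by rw [Category.assoc, h₁, h₃])
  infer_instance

theorem commuteOver_iff_kernel_comp {X Y W D : C} (x : X ⟶ D) (y : Y ⟶ D) (w : W ⟶ D) :
    CommuteOver x y w ↔
      kernel.ι (coprodToPullback X Y W) ≫ coprod.desc (coprod.desc x y) w = 0 := by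
  constructor
  · rintro ⟨φ, h⟩
    rw [← (coprodToPullback_comp_eq_iff x y w φ).2 h, kernel.condition_assoc, zero_comp]
  · intro h
    obtain ⟨φ, hφ⟩ := exists_fac_of_kernel_comp_eq_zero _ _ h
    exact ⟨φ, (coprodToPullback_comp_eq_iff x y w φ).1 hφ⟩

theorem coprodToPullback_fst (X Y W : C) :
    coprodToPullback X Y W ≫ pullback.fst _ _ =
      coprod.desc (coprod.desc coprod.inr 0) coprod.inl := by
  ext1
  · ext1 <;> simp [coprodToPullback]
  · simp [coprodToPullback]

theorem coprodToPullback_snd (X Y W : C) :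
    coprodToPullback X Y W ≫ pullback.snd _ _ =
      coprod.desc (coprod.desc 0 coprod.inr) coprod.inl := by
  ext1
  · ext1 <;> simp [coprodToPullback]
  · simp [coprodToPullback]

theorem comp_coprodToPullback_eq_zero_iff {T X Y W : C} (t : T ⟶ (X ⨿ Y) ⨿ W) :
    t ≫ coprodToPullback X Y W = 0 ↔
      t ≫ coprod.desc (coprod.desc coprod.inl 0) (coprod.inr : W ⟶ X ⨿ W) = 0 ∧
      t ≫ coprod.desc (coprod.desc 0 coprod.inl) (coprod.inr : W ⟶ Y ⨿ W) = 0 := by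
  have h₁ : (coprod.desc (coprod.desc coprod.inl 0) coprod.inr : (X ⨿ Y) ⨿ W ⟶ X ⨿ W) =
      (coprodToPullback X Y W ≫ pullback.fst _ _) ≫ (coprod.braiding W X).hom := by
    rw [coprodToPullback_fst]
    ext1
    · ext1 <;> simp
    · simp
  have h₂ : (coprod.desc (coprod.desc 0 coprod.inl) coprod.inr : (X ⨿ Y) ⨿ W ⟶ Y ⨿ W) =
      (coprodToPullback X Y W ≫ pullback.snd _ _) ≫ (coprod.braiding W Y).hom := by
    rw [coprodToPullback_snd]
    ext1
    · ext1 <;> simp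
    · simp
  rw [h₁, h₂]
  constructor
  · intro h
    constructor <;> simp [reassoc_of% h]
  · rintro ⟨h, h'⟩
    apply pullback.hom_ext
    · rw [← cancel_mono (coprod.braiding W X).hom]
      simpa using h
    · rw [← cancel_mono (coprod.braiding W Y).hom]
      simpa using h'

/-! ### Weighted commutation and the ternary co-smash product -/

/-- Exhibits the ternary co-smash product as the part of the kernel of `coprodToPullback` that dies
when `W` is killed. -/
theorem comp_coprodToProd₃_eq_zero_iff {T X Y W : C} (t : T ⟶ (X ⨿ Y) ⨿ W) :
    t ≫ coprodToProd₃ X Y W = 0 ↔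
      t ≫ coprod.desc (𝟙 (X ⨿ Y)) 0 = 0 ∧ t ≫ coprodToPullback X Y W = 0 := by
  rw [comp_coprodToPullback_eq_zero_iff]
  constructor
  · intro h
    refine ⟨?_, ?_, ?_⟩
    · simpa [coprodToProd₃] using congrArg (· ≫ prod.fst) h
    · simpa [coprodToProd₃] using congrArg (· ≫ prod.snd ≫ prod.fst) h
    · simpa [coprodToProd₃] using congrArg (· ≫ prod.snd ≫ prod.snd) h
  · rintro ⟨h₁, h₂, h₃⟩
    ext1
    · simpa [coprodToProd₃] using h₁
    · ext1
      · simpa [coprodToProd₃] using h₂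
      · simpa [coprodToProd₃] using h₃

theorem CommuteOver.kernel_comp_eq_zero {X Y W D : C} {x : X ⟶ D} {y : Y ⟶ D} {w : W ⟶ D}
    (h : CommuteOver x y w) :
    kernel.ι (coprodToProd₃ X Y W) ≫ coprod.desc (coprod.desc x y) w = 0 := by
  rw [commuteOver_iff_kernel_comp] at h
  rw [← kernel.lift_ι _ _ ((comp_coprodToProd₃_eq_zero_iff _).1 (kernel.condition _)).2,
    Category.assoc, h, comp_zero]

/-- A Huq-commuting pair commutes over a weight as soon as the ternary co-smash product vanishes:
the kernel of `X + Y + W ⟶ (W + X) ×_W (W + Y)` is generated by the binary and the ternary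
co-smash products. -/
theorem HuqCommute.commuteOver {X Y W D : C} {x : X ⟶ D} {y : Y ⟶ D} {w : W ⟶ D}
    (h : HuqCommute x y)
    (h₃ : kernel.ι (coprodToProd₃ X Y W) ≫ coprod.desc (coprod.desc x y) w = 0) :
    CommuteOver x y w := by
  rw [huqCommute_iff] at h
  rw [commuteOver_iff_kernel_comp]
  -- Killing `W` gives the retraction onto the binary co-smash product; `hs` below gives its
  -- section.
  have hr : (kernel.ι (coprodToPullback X Y W) ≫ coprod.desc (𝟙 (X ⨿ Y)) 0) ≫
      coprodToProd X Y = 0 := by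
    obtain ⟨ha, hb⟩ := (comp_coprodToPullback_eq_zero_iff _).1
      (kernel.condition (coprodToPullback X Y W))
    have e₁ : coprod.desc (𝟙 (X ⨿ Y)) (0 : W ⟶ _) ≫ coprodToProd X Y ≫ prod.fst =
        coprod.desc (coprod.desc coprod.inl 0) (coprod.inr : W ⟶ X ⨿ W) ≫
          coprod.desc (𝟙 X) 0 := by
      ext1
      · ext1 <;> simp [coprodToProd]
      · simp
    have e₂ : coprod.desc (𝟙 (X ⨿ Y)) (0 : W ⟶ _) ≫ coprodToProd X Y ≫ prod.snd =
        coprod.desc (coprod.desc 0 coprod.inl) (coprod.inr : W ⟶ Y ⨿ W) ≫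
          coprod.desc (𝟙 Y) 0 := by
      ext1
      · ext1 <;> simp [coprodToProd]
      · simp
    ext1
    · rw [Category.assoc, Category.assoc, e₁, reassoc_of% ha, zero_comp, zero_comp]
    · rw [Category.assoc, Category.assoc, e₂, reassoc_of% hb, zero_comp, zero_comp]
  have hs : (kernel.ι (coprodToProd X Y) ≫ coprod.inl) ≫ coprodToPullback X Y W = 0 := by
    have hc := kernel.condition (coprodToProd X Y)
    have ha : kernel.ι (coprodToProd X Y) ≫ coprod.desc (𝟙 X) 0 = 0 := by
      have : coprodToProd X Y ≫ prod.fst = coprod.desc (𝟙 X) 0 := by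
        ext1 <;> simp [coprodToProd]
      rw [← this, reassoc_of% hc, zero_comp]
    have hb : kernel.ι (coprodToProd X Y) ≫ coprod.desc 0 (𝟙 Y) = 0 := by
      have : coprodToProd X Y ≫ prod.snd = coprod.desc 0 (𝟙 Y) := by
        ext1 <;> simp [coprodToProd]
      rw [← this, reassoc_of% hc, zero_comp]
    rw [comp_coprodToPullback_eq_zero_iff]
    constructor
    · have : (coprod.desc coprod.inl 0 : X ⨿ Y ⟶ X ⨿ W) = coprod.desc (𝟙 X) 0 ≫ coprod.inl := by
        ext1 <;> simp
      rw [Category.assoc, coprod.inl_desc, this, reassoc_of% ha, zero_comp]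
    · have : (coprod.desc 0 coprod.inl : X ⨿ Y ⟶ Y ⨿ W) = coprod.desc 0 (𝟙 Y) ≫ coprod.inl := by
        ext1 <;> simp
      rw [Category.assoc, coprod.inl_desc, this, reassoc_of% hb, zero_comp]
  refine hom_ext_of_section_of_kernel (kernel.lift _ _ hr) (kernel.lift _ _ hs) ?_ ?_ ?_
  · rw [← cancel_mono (kernel.ι _)]
    simp
  · simpa using h
  · have hk : (kernel.ι (kernel.lift _ _ hr) ≫ kernel.ι (coprodToPullback X Y W)) ≫
        coprodToProd₃ X Y W = 0 := by
      rw [comp_coprodToProd₃_eq_zero_iff]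
      constructor
      · have hl := kernel.lift_ι _ _ hr
        rw [Category.assoc]
        exact (congrArg (kernel.ι (kernel.lift _ _ hr) ≫ ·) hl).symm.trans
          ((kernel.condition_assoc _ _).trans zero_comp)
      · rw [Category.assoc, kernel.condition, comp_zero]
    rw [comp_zero, ← Category.assoc, ← kernel.lift_ι _ _ hk, Category.assoc, h₃, comp_zero]

/-- `X × Y` maps to the weighted pullback by the coproduct inclusions on each coordinate; restrict
`φ` along this map. -/
theorem CommuteOver.huqCommute {X Y W D : C} {x : X ⟶ D} {y : Y ⟶ D} {w : W ⟶ D}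
    (h : CommuteOver x y w) : HuqCommute x y := by
  obtain ⟨φ, hx, hy⟩ := h
  have hc : (prod.fst ≫ coprod.inr : X ⨯ Y ⟶ W ⨿ X) ≫ weightProj W X =
      (prod.snd ≫ coprod.inr) ≫ weightProj W Y := by
    simp [weightProj]
  refine ⟨pullback.lift _ _ hc ≫ φ, ?_, ?_⟩
  · trans coprod.inr ≫ weightLeft W X Y ≫ φ
    · rw [← Category.assoc, ← Category.assoc]
      congr 1
      apply pullback.hom_ext <;> simp
    · simp [hx]
  · trans coprod.inr ≫ weightRight W X Y ≫ φ
    · rw [← Category.assoc, ← Category.assoc]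
      congr 1
      apply pullback.hom_ext <;> simp
    · simp [hy]

/-! ### Ternary commutators of images, and change of weight -/

theorem higgins₃_eq_bot_iff {D : C} (K L M : Subobject D) :
    higgins₃ K L M = ⊥ ↔ kernel.ι (coprodToProd₃ (K : C) (L : C) (M : C)) ≫
      coprod.desc (coprod.desc K.arrow L.arrow) M.arrow = 0 := by
  rw [higgins₃, imageSubobject_eq_bot_iff]

/-- The comparison morphism defining the ternary co-smash product is natural. -/
theorem coprodToProd₃_naturality {X Y W X' Y' W' : C} (a : X ⟶ X') (b : Y ⟶ Y') (c : W ⟶ W') :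
    coprod.map (coprod.map a b) c ≫ coprodToProd₃ X' Y' W' =
      coprodToProd₃ X Y W ≫
        prod.map (coprod.map a b) (prod.map (coprod.map a c) (coprod.map b c)) := by
  simp only [coprodToProd₃, prod.lift_map, prod.comp_lift]
  congr 1
  · ext1 <;> simp
  · congr 1 <;> (ext1 <;> [(ext1 <;> simp); simp])

theorem kernel_comp_eq_zero_of_higgins₃_eq_bot {X Y W D : C} (x : X ⟶ D) (y : Y ⟶ D) (w : W ⟶ D)
    (h : higgins₃ (imageSubobject x) (imageSubobject y) (imageSubobject w) = ⊥) :
    kernel.ι (coprodToProd₃ X Y W) ≫ coprod.desc (coprod.desc x y) w = 0 := by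
  rw [higgins₃_eq_bot_iff] at h
  have hn := coprodToProd₃_naturality (factorThruImageSubobject x) (factorThruImageSubobject y)
    (factorThruImageSubobject w)
  have hk : (kernel.ι (coprodToProd₃ X Y W) ≫
      coprod.map (coprod.map (factorThruImageSubobject x) (factorThruImageSubobject y))
        (factorThruImageSubobject w)) ≫ coprodToProd₃ _ _ _ = 0 := by
    rw [Category.assoc, hn, kernel.condition_assoc, zero_comp]
  have hd : coprod.desc (coprod.desc x y) w =
      coprod.map (coprod.map (factorThruImageSubobject x) (factorThruImageSubobject y))
        (factorThruImageSubobject w) ≫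
      coprod.desc (coprod.desc (imageSubobject x).arrow (imageSubobject y).arrow)
        (imageSubobject w).arrow := by
    ext1
    · ext1 <;> simp
    · simp
  rw [hd, ← Category.assoc, ← kernel.lift_ι _ _ hk, Category.assoc, h, comp_zero]

/-- The weight with domain the zero object is neutral. -/
theorem HuqCommute.commuteOver_zero {X Y D : C} {x : X ⟶ D} {y : Y ⟶ D} (h : HuqCommute x y)
    {Z : C} (hZ : IsZero Z) (w : Z ⟶ D) : CommuteOver x y w := by
  refine h.commuteOver ?_
  have : coprod.desc (coprod.desc x y) w =
      coprod.desc (𝟙 (X ⨿ Y)) 0 ≫ coprod.desc x y := by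
    ext1
    · simp
    · exact hZ.eq_of_src _ _
  rw [this, reassoc_of% ((comp_coprodToProd₃_eq_zero_iff _).1 (kernel.condition _)).1, zero_comp]

/-- Huq-commutation forces commutation over every weight if and only if commutation over a weight
does not depend on the weight. -/
theorem forall_commuteOver_iff {X Y D : C} (x : X ⟶ D) (y : Y ⟶ D) :
    (∀ (W : C) (w : W ⟶ D), HuqCommute x y → CommuteOver x y w) ↔
      ∀ (W W' : C) (w : W ⟶ D) (w' : W' ⟶ D), CommuteOver x y w ↔ CommuteOver x y w' := by
  constructor
  · exact fun h W W' w w' => ⟨fun hw => h W' w' hw.huqCommute, fun hw => h W w hw.huqCommute⟩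
  · obtain ⟨Z, hZ⟩ := HasZeroObject.zero (C := C)
    exact fun h W w hxy => (h Z W 0 w).1 (hxy.commuteOver_zero hZ 0)

end SemiAbelian

theorem proposition4p1 (C : Type u) [Category.{v} C] [HasZeroMorphisms C] [SemiAbelian C] :
    List.TFAE [
      -- weighted cospans: Huq-commuting implies commuting over the weight
      ∀ (X Y W D : C) (x : X ⟶ D) (y : Y ⟶ D) (w : W ⟶ D),
        SemiAbelian.HuqCommute x y → SemiAbelian.CommuteOver x y w,
      -- commuting over a weight does not depend on the weight
      ∀ (X Y D : C) (x : X ⟶ D) (y : Y ⟶ D) (W W' : C) (w : W ⟶ D) (w' : W' ⟶ D),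
        SemiAbelian.CommuteOver x y w ↔ SemiAbelian.CommuteOver x y w',
      -- vanishing of the binary commutator implies vanishing of the ternary one
      ∀ (X Y W D : C) (x : X ⟶ D) (y : Y ⟶ D) (w : W ⟶ D),
        SemiAbelian.higgins (imageSubobject x) (imageSubobject y) = ⊥ →
          SemiAbelian.higgins₃ (imageSubobject x) (imageSubobject y) (imageSubobject w) = ⊥,
      -- the same three conditions for cospans `(x, y)` of monomorphisms
      ∀ (X Y W D : C) (x : X ⟶ D) (y : Y ⟶ D) (w : W ⟶ D), Mono x → Mono y →
        SemiAbelian.HuqCommute x y → SemiAbelian.CommuteOver x y w,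
      ∀ (X Y D : C) (x : X ⟶ D) (y : Y ⟶ D), Mono x → Mono y →
        ∀ (W W' : C) (w : W ⟶ D) (w' : W' ⟶ D),
          SemiAbelian.CommuteOver x y w ↔ SemiAbelian.CommuteOver x y w',
      ∀ (X Y W D : C) (x : X ⟶ D) (y : Y ⟶ D) (w : W ⟶ D), Mono x → Mono y →
        SemiAbelian.higgins (imageSubobject x) (imageSubobject y) = ⊥ →
          SemiAbelian.higgins₃ (imageSubobject x) (imageSubobject y) (imageSubobject w) = ⊥] := by
  tfae_have 1 ↔ 2 :=
    ⟨fun h X Y D x y => (SemiAbelian.forall_commuteOver_iff x y).1 fun W w => h X Y W D x y w,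
      fun h X Y W D x y => (SemiAbelian.forall_commuteOver_iff x y).2 (h X Y D x y) W⟩
  tfae_have 4 ↔ 5 :=
    ⟨fun h X Y D x y hx hy =>
        (SemiAbelian.forall_commuteOver_iff x y).1 fun W w => h X Y W D x y w hx hy,
      fun h X Y W D x y w hx hy =>
        (SemiAbelian.forall_commuteOver_iff x y).2 (h X Y D x y hx hy) W w⟩
  tfae_have 1 → 4 := fun h X Y W D x y w _ _ => h X Y W D x y w
  tfae_have 3 → 6 := fun h X Y W D x y w _ _ => h X Y W D x y w
  tfae_have 6 → 3 := fun h X Y W D x y w hxy => by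
    have := h _ _ _ _ (imageSubobject x).arrow (imageSubobject y).arrow w inferInstance
      inferInstance
    simp only [SemiAbelian.imageSubobject_imageSubobject_arrow] at this
    exact this hxy
  -- The image inclusions are themselves a cospan of monomorphisms.
  tfae_have 4 → 3 := fun h X Y W D x y w hxy =>
    (SemiAbelian.higgins₃_eq_bot_iff _ _ _).2 (h _ _ _ _ _ _ (imageSubobject w).arrow inferInstance
      inferInstance ((SemiAbelian.higgins_eq_bot_iff _ _).1 hxy)).kernel_comp_eq_zero
  tfae_have 3 → 1 := fun h X Y W D x y w hxy =>
    hxy.commuteOver (SemiAbelian.kernel_comp_eq_zero_of_higgins₃_eq_bot x y w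
      (h X Y W D x y w ((SemiAbelian.higgins_eq_bot_iff _ _).2 hxy.imageSubobject)))
  tfae_finish
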